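/- Let $\mathcal J$ be a small (strict) 2-category, let $\mathrm{Cat}$ be the 2-category of small categories, let $[\mathcal J,\mathrm{Cat}]$ be the category of weights (2-functors $\mathcal J\to\mathrm{Cat}$) and 2-natural transformations, and let $\mathrm{Ps}(\mathcal J,\mathrm{Cat})$ have the same objects and the pseudonatural transformations as arrows. The identity-on-objects inclusion $\iota:[\mathcal J,\mathrm{Cat}]\to\mathrm{Ps}(\mathcal J,\mathrm{Cat})$ has a left adjoint $Q$, with counit $q_W:QW\to W$ at a weight $W$. Call $W$ *flexible* if $q_W$ has a 2-natural section, i.e. there is a 2-natural $s:W\to QW$ with $q_W s=1_W$. Equip $[\mathcal J,\mathrm{Cat}]$ with the projective model structure: a 2-natural transformation is a weak equivalence (respectively a fibration) if each of its components is an equivalence of categories (respectively an isofibration); hence the cofibrations are the maps with the left lifting property with respect to the maps that are both fibrations and weak equivalences. **Proposition (Lack).** A weight $W$ is cofibrant, i.e. the unique map from the initial weight to $W$ is a cofibration, if and only if $W$ is flexible. -/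

import Mathlib

open CategoryTheory Bicategory

universe u

namespace CatWeight

/-- A `J`-indexed weight: a (strict) 2-functor from `J` to the 2-category of small categories. -/
abbrev Weight (J : Type u) [Bicategory.{u, u} J] : Type (u + 1) :=
  StrictPseudofunctor J Cat.{u, u}

section

variable {J : Type u} [Bicategory.{u, u} J]

/-- The underlying pseudofunctor of a 2-functor. -/
abbrev Weight.toPs (W : Weight J) : Pseudofunctor J Cat.{u, u} :=
  W.toPseudofunctor

/-- A 2-natural transformation: a family of functors that is strictly natural with respect to
1-cells and compatible with 2-cells. -/
@[ext]
structure TwoNatTrans (W X : Weight J) where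
  app (a : J) : W.obj a ⟶ X.obj a
  naturality {a b : J} (f : a ⟶ b) : W.map f ≫ app b = app a ≫ X.map f
  naturality₂ {a b : J} {f g : a ⟶ b} (η : f ⟶ g) :
    W.map₂ η ▷ app b ≫ eqToHom (naturality g) = eqToHom (naturality f) ≫ app a ◁ X.map₂ η

/-- `[J, Cat]`: weights and 2-natural transformations. -/
instance : Category (Weight J) where
  Hom W X := TwoNatTrans W X
  id W :=
    { app := fun a => 𝟙 (W.obj a)
      naturality := fun f => by simp
      naturality₂ := fun η => by
        ext x
        simp }
  comp {W X Y} α β :=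
    { app := fun a => α.app a ≫ β.app a
      naturality := fun f => by
        rw [← Category.assoc, α.naturality, Category.assoc, β.naturality, Category.assoc]
      naturality₂ := fun {a b f g} η => by
        ext x
        have h1 := congrArg (fun t => (β.app b).toFunctor.map (t.toNatTrans.app x))
          (α.naturality₂ η)
        have h2 := congrArg (fun t => t.toNatTrans.app ((α.app a).toFunctor.obj x))
          (β.naturality₂ η)
        simp [eqToHom_map] at h1 h2 ⊢
        rw [← cancel_mono (eqToHom (congrArg (fun F => F.toFunctor.obj
          ((α.app a).toFunctor.obj x)) (β.naturality g)))] at h1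
        simp only [Category.assoc, h2, eqToHom_trans, eqToHom_trans_assoc] at h1
        exact h1 }
  id_comp α := by
    apply TwoNatTrans.ext
    funext a
    exact Category.id_comp _
  comp_id α := by
    apply TwoNatTrans.ext
    funext a
    exact Category.comp_id _
  assoc α β γ := by
    apply TwoNatTrans.ext
    funext a
    exact Category.assoc _ _ _

variable (J) in
/-- `Ps(J, Cat)`: the objects are the weights, the arrows the pseudonatural transformations.
Modifications play no role in the notion of a section of `q_W` and are omitted. -/
structure PsWeight where
  /-- The underlying 2-functor. -/
  weight : Weight J

/-- Pseudonatural transformations with the same 1-cell and 2-cell components are equal. -/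
theorem strongTrans_ext {F G : Pseudofunctor J Cat.{u, u}} {η θ : Pseudofunctor.StrongTrans F G}
    (h : ∀ a, η.app a = θ.app a)
    (h' : ∀ {a b : J} (f : a ⟶ b) (x : F.obj a),
      (η.naturality f).hom.toNatTrans.app x ≫
        eqToHom (by rw [h a]) =
      eqToHom (by rw [h b]) ≫ (θ.naturality f).hom.toNatTrans.app x) : η = θ := by
  obtain ⟨a1, n1, _, _, _⟩ := η
  obtain ⟨a2, n2, _, _, _⟩ := θ
  obtain rfl : a1 = a2 := funext h
  congr 1
  funext a b f
  ext x
  simpa using h' f x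

theorem id_nat_app (F : Pseudofunctor J Cat.{u, u}) {a b : J} (f : a ⟶ b) (x : F.obj a) :
    ((Pseudofunctor.StrongTrans.id F).naturality f).hom.toNatTrans.app x =
      𝟙 ((F.map f).toFunctor.obj x) := by
  change 𝟙 _ ≫ 𝟙 _ = _
  exact Category.comp_id _

theorem vcomp_nat_app {F G H : Pseudofunctor J Cat.{u, u}}
    (η : Pseudofunctor.StrongTrans F G) (θ : Pseudofunctor.StrongTrans G H)
    {a b : J} (f : a ⟶ b) (x : F.obj a) :
    ((η.vcomp θ).naturality f).hom.toNatTrans.app x =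
      (θ.app b).toFunctor.map ((η.naturality f).hom.toNatTrans.app x) ≫
        (θ.naturality f).hom.toNatTrans.app ((η.app a).toFunctor.obj x) := by
  change 𝟙 _ ≫ (θ.app b).toFunctor.map ((η.naturality f).hom.toNatTrans.app x) ≫ 𝟙 _ ≫
    (θ.naturality f).hom.toNatTrans.app ((η.app a).toFunctor.obj x) ≫ 𝟙 _ = _
  erw [Category.id_comp, Category.id_comp, Category.comp_id]

instance : Category (PsWeight J) where
  Hom W X := Pseudofunctor.StrongTrans W.weight.toPs X.weight.toPs
  id W := Pseudofunctor.StrongTrans.id W.weight.toPs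
  comp η θ := Pseudofunctor.StrongTrans.vcomp η θ
  id_comp η := by
    refine strongTrans_ext (fun a => Category.id_comp _) ?_
    intro a b f x
    rw [vcomp_nat_app, id_nat_app]
    change ((η.app b).toFunctor.map (𝟙 _) ≫ (η.naturality f).hom.toNatTrans.app x) ≫ 𝟙 _ =
      𝟙 _ ≫ (η.naturality f).hom.toNatTrans.app x
    rw [CategoryTheory.Functor.map_id, Category.id_comp, Category.comp_id, Category.id_comp]
  comp_id η := by
    refine strongTrans_ext (fun a => Category.comp_id _) ?_
    intro a b f x
    rw [vcomp_nat_app, id_nat_app]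
    change ((η.naturality f).hom.toNatTrans.app x ≫ 𝟙 _) ≫ 𝟙 _ =
      𝟙 _ ≫ (η.naturality f).hom.toNatTrans.app x
    rw [Category.comp_id, Category.comp_id, Category.id_comp]
  assoc η θ κ := by
    refine strongTrans_ext (fun a => Category.assoc _ _ _) ?_
    intro a b f x
    simp only [vcomp_nat_app]
    change ((κ.app b).toFunctor.map ((θ.app b).toFunctor.map
        ((η.naturality f).hom.toNatTrans.app x) ≫ (θ.naturality f).hom.toNatTrans.app
          ((η.app a).toFunctor.obj x)) ≫ (κ.naturality f).hom.toNatTrans.app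
            ((θ.app a).toFunctor.obj ((η.app a).toFunctor.obj x))) ≫ 𝟙 _ =
      𝟙 _ ≫ (κ.app b).toFunctor.map ((θ.app b).toFunctor.map
        ((η.naturality f).hom.toNatTrans.app x)) ≫ (κ.app b).toFunctor.map
          ((θ.naturality f).hom.toNatTrans.app ((η.app a).toFunctor.obj x)) ≫
            (κ.naturality f).hom.toNatTrans.app
              ((θ.app a).toFunctor.obj ((η.app a).toFunctor.obj x))
    rw [Category.comp_id, Category.id_comp, Functor.map_comp, Category.assoc]

/-- A 2-natural transformation, regarded as a pseudonatural one with identity 2-cells. -/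
def TwoNatTrans.toStrong {W X : Weight J} (α : TwoNatTrans W X) :
    Pseudofunctor.StrongTrans W.toPs X.toPs where
  app := α.app
  naturality f := eqToIso (α.naturality f)
  naturality_naturality η := by simpa using α.naturality₂ η
  naturality_id a := by
    rw [W.mapId_eq_eqToIso, X.mapId_eq_eqToIso]
    simp [Strict.leftUnitor_eqToIso, Strict.rightUnitor_eqToIso]
  naturality_comp f g := by
    rw [W.mapComp_eq_eqToIso, X.mapComp_eq_eqToIso]
    simp only [eqToIso.hom, eqToIso.inv, whiskerLeft_eqToHom, eqToHom_whiskerRight,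
      Strict.associator_eqToIso, eqToHom_trans]

theorem TwoNatTrans.toStrong_nat_app {W X : Weight J} (α : TwoNatTrans W X) {a b : J} (f : a ⟶ b)
    (x : W.obj a) : (α.toStrong.naturality f).hom.toNatTrans.app x =
      eqToHom (congrArg (fun F => F.toFunctor.obj x) (α.naturality f)) := by
  change (eqToHom (α.naturality f)).toNatTrans.app x = _
  rw [Cat.eqToHom_app]

/-- The identity-on-objects inclusion of `[J, Cat]` in `Ps(J, Cat)`. -/
def inclusion : Weight J ⥤ PsWeight J where
  obj W := ⟨W⟩
  map {W X} α := TwoNatTrans.toStrong α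
  map_id W := by
    refine strongTrans_ext (fun a => rfl) ?_
    intro a b f x
    rw [TwoNatTrans.toStrong_nat_app]
    erw [id_nat_app]
    simp
    rfl
  map_comp α β := by
    refine strongTrans_ext (fun a => rfl) ?_
    intro a b f x
    erw [vcomp_nat_app, TwoNatTrans.toStrong_nat_app, TwoNatTrans.toStrong_nat_app, TwoNatTrans.toStrong_nat_app]
    erw [eqToHom_map, eqToHom_trans, eqToHom_trans, eqToHom_trans]


namespace Weight

theorem map_comp_obj (W : Weight J) {a b c : J} (f : a ⟶ b) (g : b ⟶ c) (x : W.obj a) :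
    (W.map (f ≫ g)).toFunctor.obj x =
      (W.map g).toFunctor.obj ((W.map f).toFunctor.obj x) :=
  congrArg (fun F => F.toFunctor.obj x) (W.map_comp f g)

theorem map_id_obj (W : Weight J) (a : J) (x : W.obj a) :
    (W.map (𝟙 a)).toFunctor.obj x = x :=
  congrArg (fun F => F.toFunctor.obj x) (W.map_id a)

theorem map_comp_map (W : Weight J) {a b c : J} (f : a ⟶ b) (g : b ⟶ c) {x y : W.obj a}
    (m : x ⟶ y) :
    (W.map (f ≫ g)).toFunctor.map m = eqToHom (W.map_comp_obj f g x) ≫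
      (W.map g).toFunctor.map ((W.map f).toFunctor.map m) ≫
        eqToHom (W.map_comp_obj f g y).symm :=
  CategoryTheory.Functor.congr_hom (congrArg (fun F => F.toFunctor) (W.map_comp f g)) m

theorem map_id_map (W : Weight J) (a : J) {x y : W.obj a} (m : x ⟶ y) :
    (W.map (𝟙 a)).toFunctor.map m = eqToHom (W.map_id_obj a x) ≫ m ≫
        eqToHom (W.map_id_obj a y).symm :=
  CategoryTheory.Functor.congr_hom (congrArg (fun F => F.toFunctor) (W.map_id a)) m

theorem whiskerLeft_app (W : Weight J) {a b c : J} (f : a ⟶ b) {g h : b ⟶ c} (η : g ⟶ h)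
    (x : W.obj a) :
    (W.map₂ (f ◁ η)).toNatTrans.app x = eqToHom (W.map_comp_obj f g x) ≫
      (W.map₂ η).toNatTrans.app ((W.map f).toFunctor.obj x) ≫
        eqToHom (W.map_comp_obj f h x).symm := by
  have := W.map₂_whisker_left f η
  rw [this, W.mapComp_eq_eqToIso, W.mapComp_eq_eqToIso]
  simp

theorem whiskerRight_app (W : Weight J) {a b c : J} {f g : a ⟶ b} (η : f ⟶ g) (h : b ⟶ c)
    (x : W.obj a) :
    (W.map₂ (η ▷ h)).toNatTrans.app x = eqToHom (W.map_comp_obj f h x) ≫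
      (W.map h).toFunctor.map ((W.map₂ η).toNatTrans.app x) ≫
        eqToHom (W.map_comp_obj g h x).symm := by
  have := W.map₂_whisker_right η h
  rw [this, W.mapComp_eq_eqToIso, W.mapComp_eq_eqToIso]
  simp

end Weight

theorem map_congr_obj {C D : Type u} [Category.{u} C] [Category.{u} D] {F G : C ⥤ D} (α : F ⟶ G)
    {x y : C} (h : x = y) : α.app x = eqToHom (by rw [h]) ≫ α.app y ≫ eqToHom (by rw [h]) := by
  subst h; simp

section StrongTrans

variable {W X : Weight J} (t : Pseudofunctor.StrongTrans W.toPs X.toPs)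

theorem nat_id_app (a : J) (x : W.obj a) :
    (t.naturality (𝟙 a)).hom.toNatTrans.app x =
      eqToHom (by
        change (t.app a).toFunctor.obj ((W.map (𝟙 a)).toFunctor.obj x) =
          (X.map (𝟙 a)).toFunctor.obj ((t.app a).toFunctor.obj x)
        rw [W.map_id_obj, X.map_id_obj]) := by
  have h := t.naturality_id a
  rw [W.mapId_eq_eqToIso, X.mapId_eq_eqToIso, Strict.leftUnitor_eqToIso,
    Strict.rightUnitor_eqToIso] at h
  simp only [eqToIso.hom, eqToIso.inv, whiskerLeft_eqToHom, eqToHom_whiskerRight,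
    eqToHom_trans, comp_eqToHom_iff] at h
  rw [h, Cat.eqToHom_app]

theorem nat_comp_app {a b c : J} (f : a ⟶ b) (g : b ⟶ c) (x : W.obj a) :
    (t.naturality (f ≫ g)).hom.toNatTrans.app x =
      eqToHom (congrArg (t.app c).toFunctor.obj (W.map_comp_obj f g x)) ≫
        (t.naturality g).hom.toNatTrans.app ((W.map f).toFunctor.obj x) ≫
          (X.map g).toFunctor.map ((t.naturality f).hom.toNatTrans.app x) ≫
            eqToHom (X.map_comp_obj f g _).symm := by
  have h := t.naturality_comp f g
  rw [W.mapComp_eq_eqToIso, X.mapComp_eq_eqToIso, Strict.associator_eqToIso,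
    Strict.associator_eqToIso, Strict.associator_eqToIso] at h
  simp only [eqToIso.hom, eqToIso.inv, whiskerLeft_eqToHom, eqToHom_whiskerRight,
    comp_eqToHom_iff] at h
  rw [h]
  simp

theorem nat_nat_app {a b : J} {f g : a ⟶ b} (η : f ⟶ g) (x : W.obj a) :
    (t.app b).toFunctor.map ((W.map₂ η).toNatTrans.app x) ≫
      (t.naturality g).hom.toNatTrans.app x =
    (t.naturality f).hom.toNatTrans.app x ≫
      (X.map₂ η).toNatTrans.app ((t.app a).toFunctor.obj x) :=
  congrArg (fun α => α.toNatTrans.app x) (t.naturality_naturality η)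

theorem nat_natural {a b : J} (f : a ⟶ b) {x y : W.obj a} (m : x ⟶ y) :
    (t.app b).toFunctor.map ((W.map f).toFunctor.map m) ≫
      (t.naturality f).hom.toNatTrans.app y =
    (t.naturality f).hom.toNatTrans.app x ≫
      (X.map f).toFunctor.map ((t.app a).toFunctor.map m) :=
  (t.naturality f).hom.toNatTrans.naturality m

theorem nat_id_inv_app (a : J) (x : W.obj a) :
    (t.naturality (𝟙 a)).inv.toNatTrans.app x =
      eqToHom (by
        change (X.map (𝟙 a)).toFunctor.obj ((t.app a).toFunctor.obj x) =
          (t.app a).toFunctor.obj ((W.map (𝟙 a)).toFunctor.obj x)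
        rw [W.map_id_obj, X.map_id_obj]) := by
  rw [← cancel_epi ((t.naturality (𝟙 a)).hom.toNatTrans.app x),
    Cat.Hom.hom_inv_id_toNatTrans_app, nat_id_app, eqToHom_trans, eqToHom_refl]

theorem nat_congr {a b : J} {f g : a ⟶ b} (h : f = g) (x : W.obj a) :
    (t.naturality f).hom.toNatTrans.app x = eqToHom (by rw [h]) ≫
      (t.naturality g).hom.toNatTrans.app x ≫ eqToHom (by rw [h]) := by
  subst h; simp

end StrongTrans

/-- The objects of `QW` at `j`: formal values `f · x` with `f : i ⟶ j` and `x` in `W i`. -/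
structure QObj (W : Weight J) (j : J) : Type u where
  src : J
  arr : src ⟶ j
  elt : W.obj src

namespace QObj

/-- The actual value `W(f)(x)`. -/
abbrev eval {W : Weight J} {j : J} (q : QObj W j) : W.obj j := (W.map q.arr).toFunctor.obj q.elt

/-- An arrow of `QW` at `j` is an arrow between the actual values. -/
@[ext]
structure Hom {W : Weight J} {j : J} (p q : QObj W j) : Type u where
  val : p.eval ⟶ q.eval

instance (W : Weight J) (j : J) : Category.{u} (QObj W j) where
  Hom p q := Hom p q
  id p := ⟨𝟙 p.eval⟩
  comp m n := ⟨m.val ≫ n.val⟩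
  id_comp m := Hom.ext (Category.id_comp m.val)
  comp_id m := Hom.ext (Category.comp_id m.val)
  assoc m n o := Hom.ext (Category.assoc m.val n.val o.val)

@[ext]
theorem hom_ext {W : Weight J} {j : J} {p q : QObj W j} {m n : p ⟶ q} (h : m.val = n.val) :
    m = n := Hom.ext h

@[simp]
theorem id_val {W : Weight J} {j : J} (p : QObj W j) : (𝟙 p : p ⟶ p).val = 𝟙 p.eval := rfl

@[simp]
theorem comp_val {W : Weight J} {j : J} {p q r : QObj W j} (m : p ⟶ q) (n : q ⟶ r) :
    (m ≫ n).val = m.val ≫ n.val := rfl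

@[simp]
theorem eqToHom_val {W : Weight J} {j : J} {p q : QObj W j} (h : p = q) :
    (eqToHom h).val = eqToHom (congrArg eval h) := by
  subst h; rfl

/-- The action of a 1-cell `g` of `J` on the objects of `QW`. -/
abbrev push {W : Weight J} {j k : J} (g : j ⟶ k) (q : QObj W j) : QObj W k :=
  ⟨q.src, q.arr ≫ g, q.elt⟩

theorem eval_push {W : Weight J} {j k : J} (g : j ⟶ k) (q : QObj W j) :
    (push g q).eval = (W.map g).toFunctor.obj q.eval :=
  W.map_comp_obj q.arr g q.elt

/-- Isomorphisms in `QW` at `j` from isomorphisms between actual values. -/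
def isoMk {W : Weight J} {j : J} {p q : QObj W j} (m : p.eval ≅ q.eval) : p ≅ q where
  hom := ⟨m.hom⟩
  inv := ⟨m.inv⟩
  hom_inv_id := by ext; exact m.hom_inv_id
  inv_hom_id := by ext; exact m.inv_hom_id

/-- The action of a 1-cell `g` of `J` on `QW`, as a functor. -/
abbrev mapFunctor (W : Weight J) {j k : J} (g : j ⟶ k) : QObj W j ⥤ QObj W k where
  obj q := push g q
  map {p q} m := ⟨eqToHom (eval_push g p) ≫
    (W.map g).toFunctor.map m.val ≫ eqToHom (eval_push g q).symm⟩
  map_id p := by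
    apply hom_ext
    simp
  map_comp m n := by
    apply hom_ext
    simp

@[simp]
theorem mapFunctor_obj (W : Weight J) {j k : J} (g : j ⟶ k) (q : QObj W j) :
    (mapFunctor W g).obj q = push g q := rfl

@[simp]
theorem mapFunctor_map (W : Weight J) {j k : J} (g : j ⟶ k) {p q : QObj W j} (m : p ⟶ q) :
    ((mapFunctor W g).map m).val = eqToHom (eval_push g p) ≫
    (W.map g).toFunctor.map m.val ≫ eqToHom (eval_push g q).symm := rfl

/-- The action of a 2-cell of `J` on `QW`. -/
abbrev mapNat (W : Weight J) {j k : J} {g h : j ⟶ k} (η : g ⟶ h) :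
    mapFunctor W g ⟶ mapFunctor W h where
  app q := ⟨eqToHom (eval_push g q) ≫ (W.map₂ η).toNatTrans.app q.eval ≫
    eqToHom (eval_push h q).symm⟩
  naturality p q m := by
    apply hom_ext
    rw [comp_val, comp_val]
    simp

@[simp]
theorem mapNat_app (W : Weight J) {j k : J} {g h : j ⟶ k} (η : g ⟶ h) (q : QObj W j) :
    ((mapNat W η).app q).val = eqToHom (eval_push g q) ≫
      (W.map₂ η).toNatTrans.app q.eval ≫ eqToHom (eval_push h q).symm := rfl

end QObj

theorem QObj.conj_val {W : Weight J} {j : J} {C : Cat.{u, u}} {F F' G G' : C ⟶ Cat.of (QObj W j)}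
    (h : F = F') (β : F' ⟶ G') (h' : G' = G) (x : C) :
    ((eqToHom h ≫ β ≫ eqToHom h').toNatTrans.app x).val =
      eqToHom (congrArg (fun F : C ⟶ Cat.of (QObj W j) => (F.toFunctor.obj x).eval) h) ≫
        (β.toNatTrans.app x).val ≫
          eqToHom (congrArg (fun F : C ⟶ Cat.of (QObj W j) => (F.toFunctor.obj x).eval) h') := by
  subst h h'
  simp

theorem eqToHom_app_val {W : Weight J} {j : J} {C : Cat.{u, u}} {F F' : C ⟶ Cat.of (QObj W j)}
    (h : F = F') (x : C) :
    ((eqToHom h).toNatTrans.app x).val =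
      eqToHom (congrArg (fun F : C ⟶ Cat.of (QObj W j) => (F.toFunctor.obj x).eval) h) := by
  subst h
  rfl

theorem comp_eqToHom_eqToHom {C : Type u} [Category.{u} C] {x y z w : C} (m : x ⟶ y) (h : y = z)
    (h' : z = w) : (m ≫ eqToHom h) ≫ eqToHom h' = m ≫ eqToHom (h.trans h') := by
  simp

theorem eqToHom_cancel_mid {C : Type u} [Category.{u} C] {x y z w : C} (m : x ⟶ y) (h : z = y)
    (n : y ⟶ w) : (m ≫ eqToHom h.symm) ≫ eqToHom h ≫ n = m ≫ n := by
  simp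

variable [Bicategory.Strict J]

theorem QObj.push_id {W : Weight J} {j : J} (q : QObj W j) : QObj.push (𝟙 j) q = q := by
  obtain ⟨i, f, x⟩ := q
  simp [QObj.push]

theorem QObj.push_comp {W : Weight J} {j k l : J} (g : j ⟶ k) (h : k ⟶ l) (q : QObj W j) :
    QObj.push (g ≫ h) q = QObj.push h (QObj.push g q) := by
  obtain ⟨i, f, x⟩ := q
  simp [QObj.push]

open QObj in
/-- The weight `QW`. On arrows and 2-cells it is determined by requiring evaluation
`QW ⟶ W` to be 2-natural. -/
def QWeight (W : Weight J) : Weight J := StrictPseudofunctor.mk''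
  { obj := fun j => Cat.of (QObj W j)
    map := fun g => Functor.toCatHom (C := QObj W _) (D := QObj W _) (mapFunctor W g)
    map₂ := fun η => (mapNat W η).toCatHom₂
    map₂_id := fun f => by
      ext q
      apply hom_ext
      dsimp
      simp
      rfl
    map₂_comp := fun η θ => by
      ext q
      apply hom_ext
      dsimp
      erw [comp_val]
      simp
    map_id := fun j => by
      ext1
      refine CategoryTheory.Functor.ext (fun q => push_id q) (fun p q m => ?_)
      apply hom_ext
      erw [comp_val, comp_val, eqToHom_val, eqToHom_val]
      simp [Weight.map_id_map]
      rfl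
    map_comp := fun f g => by
      ext1
      refine CategoryTheory.Functor.ext (fun q => push_comp f g q) (fun p q m => ?_)
      apply hom_ext
      erw [comp_val, comp_val, eqToHom_val, eqToHom_val]
      change ((mapFunctor W (f ≫ g)).map m).val = eqToHom _ ≫ (eqToHom (eval_push g _) ≫
        (W.map g).toFunctor.map (eqToHom (eval_push f p) ≫ (W.map f).toFunctor.map m.val ≫
          eqToHom (eval_push f q).symm) ≫ eqToHom (eval_push g _).symm) ≫ eqToHom _
      simp [Weight.map_comp_map, eqToHom_map]
    map₂_whisker_left := fun f g g' η => by
      ext q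
      apply hom_ext
      refine Eq.trans ?_ (conj_val _ _ _ q).symm
      change eqToHom (eval_push _ q) ≫ (W.map₂ (f ◁ η)).toNatTrans.app (eval q) ≫
          eqToHom (eval_push _ q).symm = eqToHom _ ≫ (eqToHom (eval_push _ _) ≫
        (W.map₂ η).toNatTrans.app (push f q).eval ≫ eqToHom (eval_push _ _).symm) ≫ eqToHom _
      rw [Weight.whiskerLeft_app, map_congr_obj (W.map₂ η).toNatTrans (eval_push f q)]
      simp
    map₂_whisker_right := fun η g => by
      ext q
      apply hom_ext
      refine Eq.trans ?_ (conj_val _ _ _ q).symm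
      change eqToHom (eval_push _ q) ≫ (W.map₂ (η ▷ g)).toNatTrans.app (eval q) ≫
          eqToHom (eval_push _ q).symm = eqToHom _ ≫ (eqToHom (eval_push _ _) ≫
        (W.map g).toFunctor.map (eqToHom (eval_push _ q) ≫ (W.map₂ η).toNatTrans.app (eval q) ≫
          eqToHom (eval_push _ q).symm) ≫ eqToHom (eval_push _ _).symm) ≫ eqToHom _
      rw [Weight.whiskerRight_app]
      simp [eqToHom_map] }


/-- The components of `p_W : W ⇝ QW`, sending `x` to the formal value `1 · x`. -/
abbrev unitApp (W : Weight J) (a : J) : W.obj a ⥤ QObj W a where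
  obj x := ⟨a, 𝟙 a, x⟩
  map {x y} m := ⟨(W.map (𝟙 a)).toFunctor.map m⟩
  map_id x := by
    apply QObj.hom_ext
    simp [QObj.eval]
  map_comp m n := QObj.hom_ext ((W.map (𝟙 a)).toFunctor.map_comp m n)

theorem unit_eval (W : Weight J) {a b : J} (f : a ⟶ b) (x : W.obj a) :
    ((unitApp W b).obj ((W.map f).toFunctor.obj x)).eval =
      (QObj.push f ((unitApp W a).obj x)).eval := by
  rw [QObj.eval_push]
  exact (W.map_id_obj b _).trans (congrArg (W.map f).toFunctor.obj (W.map_id_obj a x)).symm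

/-- The pseudonaturality isomorphisms of `p_W`. -/
def unitNat (W : Weight J) {a b : J} (f : a ⟶ b) :
    (W.map f).toFunctor ⋙ unitApp W b ≅ unitApp W a ⋙ QObj.mapFunctor W f :=
  NatIso.ofComponents (fun x => QObj.isoMk (eqToIso (unit_eval W f x))) (fun {x y} m => by
    apply QObj.hom_ext
    change (W.map (𝟙 b)).toFunctor.map ((W.map f).toFunctor.map m) ≫ eqToHom (unit_eval W f y) =
      eqToHom (unit_eval W f x) ≫ eqToHom (QObj.eval_push _ _) ≫
        (W.map f).toFunctor.map ((W.map (𝟙 a)).toFunctor.map m) ≫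
          eqToHom (QObj.eval_push f ((unitApp W a).obj y)).symm
    rw [W.map_id_map, W.map_id_map]
    simp [eqToHom_map])

/-- The pseudonatural transformation `p_W : W ⇝ QW`. -/
def unit (W : Weight J) : Pseudofunctor.StrongTrans W.toPs (QWeight W).toPs where
  app a := (unitApp W a).toCatHom
  naturality f := Cat.Hom.isoMk (unitNat W f)
  naturality_naturality {a b f g} η := by
    ext x
    apply QObj.hom_ext
    change (W.map (𝟙 b)).toFunctor.map ((W.map₂ η).toNatTrans.app x) ≫
      eqToHom (unit_eval W g x) = eqToHom (unit_eval W f x) ≫ eqToHom (QObj.eval_push _ _) ≫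
        (W.map₂ η).toNatTrans.app ((W.map (𝟙 a)).toFunctor.obj x) ≫
          eqToHom (QObj.eval_push g ((unitApp W a).obj x)).symm
    rw [W.map_id_map, map_congr_obj (W.map₂ η).toNatTrans (W.map_id_obj a x)]
    simp
  naturality_id a := by
    rw [W.mapId_eq_eqToIso, (QWeight W).mapId_eq_eqToIso]
    ext x
    apply QObj.hom_ext
    have h1 := eqToHom_app_val ((QWeight W).map_id a) ((unitApp W a).obj x)
    have h2 := eqToHom_map (unitApp W a) (W.map_id_obj a x)
    have h3 : (eqToHom (W.map_id a)).toNatTrans.app x = eqToHom (W.map_id_obj a x) :=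
      Cat.eqToHom_app _ _ _ _
    change eqToHom (unit_eval W (𝟙 a) x) ≫
      ((eqToHom ((QWeight W).map_id a)).toNatTrans.app ((unitApp W a).obj x)).val =
      ((unitApp W a).map ((eqToHom (W.map_id a)).toNatTrans.app x)).val ≫ 𝟙 _ ≫ 𝟙 _
    erw [h1, h3, h2, QObj.eqToHom_val, Category.comp_id, Category.comp_id, eqToHom_trans]
  naturality_comp {a b c} f g := by
    rw [W.mapComp_eq_eqToIso, (QWeight W).mapComp_eq_eqToIso]
    ext x
    apply QObj.hom_ext
    have h1 := eqToHom_app_val ((QWeight W).map_comp f g) ((unitApp W a).obj x)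
    have h2 := eqToHom_map (unitApp W c) (W.map_comp_obj f g x)
    have h3 : (eqToHom (W.map_comp f g)).toNatTrans.app x = eqToHom (W.map_comp_obj f g x) :=
      Cat.eqToHom_app _ _ _ _
    have h4 := eqToHom_map (W.map g).toFunctor (unit_eval W f x)
    change eqToHom (unit_eval W (f ≫ g) x) ≫
      ((eqToHom ((QWeight W).map_comp f g)).toNatTrans.app ((unitApp W a).obj x)).val =
      ((unitApp W c).map ((eqToHom (W.map_comp f g)).toNatTrans.app x)).val ≫ 𝟙 _ ≫
        eqToHom (unit_eval W g ((W.map f).toFunctor.obj x)) ≫ 𝟙 _ ≫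
          (eqToHom (QObj.eval_push g _) ≫ (W.map g).toFunctor.map (eqToHom (unit_eval W f x)) ≫
            eqToHom (QObj.eval_push g (QObj.push f ((unitApp W a).obj x))).symm) ≫ 𝟙 _
    erw [h1, h3, h2, h4, QObj.eqToHom_val, Category.comp_id, Category.id_comp, Category.id_comp, eqToHom_trans, eqToHom_trans,
      eqToHom_trans, eqToHom_trans, eqToHom_trans]
    rfl

section Lift

variable {W X : Weight J} (t : Pseudofunctor.StrongTrans W.toPs X.toPs)

theorem lift_map_aux {i i' j k : J} (u : i ⟶ j) (u' : i' ⟶ j) (g : j ⟶ k) (x : W.obj i)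
    (x' : W.obj i') (m : (W.map u).toFunctor.obj x ⟶ (W.map u').toFunctor.obj x') :
    (t.naturality (u ≫ g)).inv.toNatTrans.app x ≫
      (t.app k).toFunctor.map (eqToHom (W.map_comp_obj u g x) ≫
        (W.map g).toFunctor.map m ≫ eqToHom (W.map_comp_obj u' g x').symm) ≫
        (t.naturality (u' ≫ g)).hom.toNatTrans.app x' =
    eqToHom (X.map_comp_obj _ _ _) ≫
      (X.map g).toFunctor.map ((t.naturality u).inv.toNatTrans.app x ≫
        (t.app j).toFunctor.map m ≫ (t.naturality u').hom.toNatTrans.app x') ≫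
        eqToHom (X.map_comp_obj _ _ _).symm := by
  have h := nat_natural t g m
  have h' : (X.map g).toFunctor.map ((t.naturality u).hom.toNatTrans.app x) ≫
      (X.map g).toFunctor.map ((t.naturality u).inv.toNatTrans.app x) = 𝟙 _ := by
    rw [← Functor.map_comp, Cat.Hom.hom_inv_id_toNatTrans_app, CategoryTheory.Functor.map_id]
  rw [← cancel_epi ((t.naturality (u ≫ g)).hom.toNatTrans.app x)]
  rw [Cat.Hom.hom_inv_id_toNatTrans_app_assoc, nat_comp_app, nat_comp_app]
  simp only [Functor.map_comp, eqToHom_map, Category.assoc]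
  erw [eqToHom_trans_assoc, eqToHom_trans_assoc, eqToHom_refl, Category.id_comp, reassoc_of% h,
    eqToHom_refl, Category.id_comp, reassoc_of% h']

theorem lift_map₂_aux {i j k : J} (u : i ⟶ j) {f g : j ⟶ k} (η : f ⟶ g) (x : W.obj i) :
    (t.naturality (u ≫ f)).inv.toNatTrans.app x ≫
      (t.app k).toFunctor.map (eqToHom (W.map_comp_obj u f x) ≫
        (W.map₂ η).toNatTrans.app ((W.map u).toFunctor.obj x) ≫
          eqToHom (W.map_comp_obj u g x).symm) ≫
        (t.naturality (u ≫ g)).hom.toNatTrans.app x =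
    eqToHom (X.map_comp_obj u f _) ≫ (X.map₂ η).toNatTrans.app
        ((X.map u).toFunctor.obj ((t.app i).toFunctor.obj x)) ≫
      eqToHom (X.map_comp_obj u g _).symm := by
  rw [← cancel_epi ((t.naturality (u ≫ f)).hom.toNatTrans.app x)]
  rw [Cat.Hom.hom_inv_id_toNatTrans_app_assoc, nat_comp_app, nat_comp_app]
  have h := nat_nat_app t η ((W.map u).toFunctor.obj x)
  have h' := (X.map₂ η).toNatTrans.naturality ((t.naturality u).hom.toNatTrans.app x)
  simp only [Functor.map_comp, eqToHom_map, Category.assoc]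
  erw [eqToHom_trans_assoc, eqToHom_trans_assoc, eqToHom_refl, Category.id_comp, reassoc_of% h,
    eqToHom_refl, Category.id_comp, reassoc_of% h']
  rfl

/-- The components of the 2-natural transformation induced by a pseudonatural one. -/
def liftApp (j : J) : QObj W j ⥤ X.obj j where
  obj q := (X.map q.arr).toFunctor.obj ((t.app q.src).toFunctor.obj q.elt)
  map {p q} m := (t.naturality p.arr).inv.toNatTrans.app p.elt ≫
    (t.app j).toFunctor.map m.val ≫ (t.naturality q.arr).hom.toNatTrans.app q.elt
  map_id p := by
    erw [QObj.id_val, CategoryTheory.Functor.map_id, Category.id_comp]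
    exact Cat.Hom.inv_hom_id_toNatTrans_app _ _
  map_comp {p q r} m n := by
    rw [QObj.comp_val]
    erw [Functor.map_comp]
    simp

/-- The 2-natural `QW ⟶ X` corresponding to a pseudonatural `W ⇝ X`. -/
def lift : TwoNatTrans (QWeight W) X where
  app j := (liftApp t j).toCatHom
  naturality {j k} g := by
    ext1
    exact CategoryTheory.Functor.ext (fun q => X.map_comp_obj _ _ _)
      (fun p q m => lift_map_aux t p.arr q.arr g p.elt q.elt m.val)
  naturality₂ {j k f g} η := by
    ext q
    rw [Cat.Hom₂.comp_app, Cat.Hom₂.comp_app, Cat.eqToHom_app, Cat.eqToHom_app]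
    change ((t.naturality (q.arr ≫ f)).inv.toNatTrans.app q.elt ≫
      (t.app k).toFunctor.map (eqToHom (W.map_comp_obj q.arr f q.elt) ≫
        (W.map₂ η).toNatTrans.app q.eval ≫ eqToHom (W.map_comp_obj q.arr g q.elt).symm) ≫
        (t.naturality (q.arr ≫ g)).hom.toNatTrans.app q.elt) ≫ eqToHom _ =
      eqToHom _ ≫ (X.map₂ η).toNatTrans.app
        ((X.map q.arr).toFunctor.obj ((t.app q.src).toFunctor.obj q.elt))
    rw [lift_map₂_aux]
    simp only [Category.assoc]
    erw [eqToHom_trans]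
    exact congrArg _ (Category.comp_id _)

/-- A pseudonatural `t : W ⇝ X` factors through `p_W` as the 2-natural `lift t`. -/
theorem unit_lift : (unit W).vcomp (lift t).toStrong = t := by
  refine strongTrans_ext (fun a => ?_) ?_
  · ext1
    refine CategoryTheory.Functor.ext (fun x => X.map_id_obj _ _) (fun x y m => ?_)
    change (t.naturality (𝟙 a)).inv.toNatTrans.app x ≫
      (t.app a).toFunctor.map ((W.map (𝟙 a)).toFunctor.map m) ≫
      (t.naturality (𝟙 a)).hom.toNatTrans.app y = eqToHom _ ≫ (t.app a).toFunctor.map m ≫ eqToHom _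
    rw [nat_natural, Cat.Hom.inv_hom_id_toNatTrans_app_assoc]
    exact X.map_id_map a _
  · intro a b f x
    rw [vcomp_nat_app, TwoNatTrans.toStrong_nat_app]
    have h1 := eqToHom_map (t.app b).toFunctor (unit_eval W f x)
    change (((t.naturality (𝟙 b)).inv.toNatTrans.app ((W.map f).toFunctor.obj x) ≫
      (t.app b).toFunctor.map (eqToHom (unit_eval W f x)) ≫
        (t.naturality (𝟙 a ≫ f)).hom.toNatTrans.app x) ≫ eqToHom _) ≫ eqToHom _ = _
    rw [nat_id_inv_app, nat_congr t (Category.id_comp f)]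
    erw [h1]
    simp only [Category.assoc]
    erw [eqToHom_trans_assoc, eqToHom_trans_assoc, eqToHom_trans, eqToHom_trans]
    exact congrArg _ (Category.comp_id _)

theorem push_unit {j : J} (q : QObj W j) :
    QObj.push q.arr ((unitApp W q.src).obj q.elt) = q := by
  obtain ⟨i, f, x⟩ := q
  simp [QObj.push]

theorem lift_unit_obj (h : TwoNatTrans (QWeight W) X) {j : J} (q : QObj W j) :
    (X.map q.arr).toFunctor.obj ((h.app q.src).toFunctor.obj ((unitApp W q.src).obj q.elt)) =
      (h.app j).toFunctor.obj q :=
  (congrArg (fun F => F.toFunctor.obj ((unitApp W q.src).obj q.elt))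
    (h.naturality q.arr)).symm.trans (congrArg (h.app j).toFunctor.obj (push_unit q))

theorem lift_unit_nat (h : TwoNatTrans (QWeight W) X) {j : J} (q : QObj W j) :
    (((unit W).vcomp h.toStrong).naturality q.arr).hom.toNatTrans.app q.elt =
      (h.app j).toFunctor.map ((unitNat W q.arr).hom.app q.elt ≫ eqToHom (push_unit q)) ≫
        eqToHom (lift_unit_obj h q).symm := by
  rw [vcomp_nat_app, TwoNatTrans.toStrong_nat_app]
  erw [Functor.map_comp, eqToHom_map]
  exact (comp_eqToHom_eqToHom _ _ _).symm

theorem unitApp_map_comp {j : J} {p q : QObj W j} (m : p ⟶ q) :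
    (unitApp W j).map m.val ≫ (unitNat W q.arr).hom.app q.elt ≫ eqToHom (push_unit q) =
      ((unitNat W p.arr).hom.app p.elt ≫ eqToHom (push_unit p)) ≫ m := by
  apply QObj.hom_ext
  change (W.map (𝟙 j)).toFunctor.map m.val ≫ eqToHom (unit_eval W q.arr q.elt) ≫
    (eqToHom (push_unit q)).val =
      (eqToHom (unit_eval W p.arr p.elt) ≫ (eqToHom (push_unit p)).val) ≫ m.val
  rw [QObj.eqToHom_val, QObj.eqToHom_val, W.map_id_map]
  simp only [Category.assoc]
  erw [eqToHom_trans, eqToHom_trans, eqToHom_trans_assoc]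
  exact congrArg _ (Category.comp_id _)

theorem lift_unit_map (h : TwoNatTrans (QWeight W) X) {j : J} {p q : QObj W j} (m : p ⟶ q) :
    (((unit W).vcomp h.toStrong).naturality p.arr).inv.toNatTrans.app p.elt ≫
      (h.app j).toFunctor.map ((unitApp W j).map m.val) ≫
        (((unit W).vcomp h.toStrong).naturality q.arr).hom.toNatTrans.app q.elt =
    eqToHom (lift_unit_obj h p) ≫ (h.app j).toFunctor.map m ≫
      eqToHom (lift_unit_obj h q).symm := by
  refine (cancel_epi ((((unit W).vcomp h.toStrong).naturality
    p.arr).hom.toNatTrans.app p.elt)).1 ?_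
  refine (Cat.Hom.hom_inv_id_toNatTrans_app_assoc _ _ _).trans ?_
  rw [lift_unit_nat, lift_unit_nat]
  refine (Category.assoc _ _ _).symm.trans ?_
  refine (congrArg (fun z => z ≫ eqToHom (lift_unit_obj h q).symm)
    (((h.app j).toFunctor.map_comp _ _).symm.trans
      ((congrArg (h.app j).toFunctor.map (unitApp_map_comp m)).trans
        ((h.app j).toFunctor.map_comp _ _)))).trans ?_
  exact (Category.assoc _ _ _).trans (eqToHom_cancel_mid _ _ _).symm

/-- The factorisation through `p_W` is unique. -/
theorem lift_unit (h : TwoNatTrans (QWeight W) X) : lift ((unit W).vcomp h.toStrong) = h := by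
  apply TwoNatTrans.ext
  funext j
  ext1
  exact CategoryTheory.Functor.ext (fun q => lift_unit_obj h q) (fun p q m => lift_unit_map h m)

end Lift

/-- `QW` is a pseudomorphism classifier: `[J, Cat](QW, X) ≅ Ps(J, Cat)(W, X)`. -/
def equiv (W : PsWeight J) (X : Weight J) : (QWeight W.weight ⟶ X) ≃ (W ⟶ inclusion.obj X) where
  toFun h := (show W ⟶ inclusion.obj (QWeight W.weight) from unit W.weight) ≫ inclusion.map h
  invFun t := lift t
  left_inv h := lift_unit h
  right_inv t := unit_lift t

theorem equiv_comp (W : PsWeight J) (X X' : Weight J) (g : X ⟶ X') (h : QWeight W.weight ⟶ X) :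
    equiv W X' (h ≫ g) = equiv W X h ≫ inclusion.map g := by
  change _ ≫ inclusion.map (h ≫ g) = (_ ≫ inclusion.map h) ≫ _
  rw [Functor.map_comp, Category.assoc]

/-- The functor `Q : Ps(J, Cat) ⥤ [J, Cat]` taking `W` to `QW`. -/
def Q : PsWeight J ⥤ Weight J := Adjunction.leftAdjointOfEquiv (G := inclusion) equiv equiv_comp

/-- `Q` is left adjoint to the inclusion of `[J, Cat]` in `Ps(J, Cat)`. -/
def adj : Q (J := J) ⊣ inclusion := Adjunction.adjunctionOfEquivLeft _ _

/-- The counit `q_W : QW ⟶ W`. -/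
def q (W : Weight J) : Q.obj (inclusion.obj W) ⟶ W := adj.counit.app W

/-- A weight is flexible when `q_W : QW ⟶ W` has a section in `[J, Cat]`. -/
def IsFlexible (W : Weight J) : Prop :=
  ∃ s : W ⟶ Q.obj (inclusion.obj W), s ≫ q W = 𝟙 W

end

section ModelStructure

/-- Isofibrations of categories: isomorphisms `F x ≅ y` lift to isomorphisms with source `x`. -/
def IsIsofibration {C D : Cat.{u, u}} (F : C ⟶ D) : Prop :=
  ∀ (x : C) (y : D) (e : F.toFunctor.obj x ≅ y),
    ∃ (z : C) (i : x ≅ z) (h : F.toFunctor.obj z = y), F.toFunctor.map i.hom ≫ eqToHom h = e.hom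

variable (J : Type u) [Bicategory.{u, u} J]

/-- The 2-natural transformations whose components are isofibrations. -/
def pointwiseIsofibrations : MorphismProperty (Weight J) :=
  fun _ _ α => ∀ j, IsIsofibration (TwoNatTrans.app α j)

/-- The 2-natural transformations whose components are equivalences of categories. -/
def pointwiseEquivalences : MorphismProperty (Weight J) :=
  fun _ _ α => ∀ j, (TwoNatTrans.app α j).toFunctor.IsEquivalence

/-- The projective cofibrations: the morphisms with the left lifting property with respect to
those that are both a pointwise isofibration and a pointwise equivalence. -/
def projectiveCofibrations : MorphismProperty (Weight J) :=
  (pointwiseIsofibrations J ⊓ pointwiseEquivalences J).llp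

/-- A model structure on `[J, Cat]` is projective when its fibrations and weak equivalences are
defined pointwise as in `Cat`. -/
def IsProjective [HomotopicalAlgebra.ModelCategory (Weight J)] : Prop :=
  HomotopicalAlgebra.fibrations (Weight J) = pointwiseIsofibrations J ∧
    HomotopicalAlgebra.weakEquivalences (Weight J) = pointwiseEquivalences J

/-- The cofibrations of a projective model structure are the projective cofibrations. -/
theorem IsProjective.cofibrations_eq [HomotopicalAlgebra.ModelCategory (Weight J)]
    (h : IsProjective J) :
    HomotopicalAlgebra.cofibrations (Weight J) = projectiveCofibrations J := by
  rw [projectiveCofibrations, ← h.1, ← h.2]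
  exact (MorphismProperty.llp_eq_of_wfs (HomotopicalAlgebra.cofibrations (Weight J))
    (HomotopicalAlgebra.trivialFibrations (Weight J))).symm

/-- The constant weight at the empty category. -/
def emptyWeight : Weight J := StrictPseudofunctor.mk'
  { obj := fun _ => Cat.of (Discrete PEmpty.{u + 1})
    map := fun _ => 𝟙 _
    map₂ := fun _ => 𝟙 _
    map_id := fun _ => rfl
    map_comp := fun _ _ => rfl
    map₂_whisker_left := fun _ _ _ _ => by ext x; exact x.as.elim
    map₂_whisker_right := fun _ _ => by ext x; exact x.as.elim
    map₂_left_unitor := fun _ => by ext x; exact x.as.elim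
    map₂_right_unitor := fun _ => by ext x; exact x.as.elim
    map₂_associator := fun _ _ _ => by ext x; exact x.as.elim }

/-- The only 2-natural transformation out of the empty weight. -/
def fromEmptyWeight (W : Weight J) : TwoNatTrans (emptyWeight J) W where
  app _ := Functor.toCatHom (Discrete.functor (fun x => x.elim))
  naturality _ := by
    ext1
    exact CategoryTheory.Functor.ext (fun x => x.as.elim) (fun x => x.as.elim)
  naturality₂ _ := by
    ext x
    exact x.as.elim

theorem fromEmptyWeight_unique {W : Weight J} (α : TwoNatTrans (emptyWeight J) W) :
    α = fromEmptyWeight J W := by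
  apply TwoNatTrans.ext
  funext j
  ext1
  exact CategoryTheory.Functor.ext (fun x => x.as.elim) (fun x => x.as.elim)

instance : Limits.HasInitial (Weight J) :=
  (Limits.IsInitial.ofUniqueHom (X := emptyWeight J) (fun W => fromEmptyWeight J W)
    (fun _ α => fromEmptyWeight_unique J α)).hasInitial

end ModelStructure

end CatWeight

/-!
Both implications are lifting problems against pointwise trivial fibrations, and rest on two facts.

* The counit `q_W : QW ⟶ W` is a pointwise trivial fibration (`q_trivialFibration`). An arrow of
  `QW` at `j` is an arrow between evaluations, so evaluation is fully faithful, and it is surjective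
  on objects.
* `QW` has the left lifting property with respect to pointwise trivial fibrations `p`
  (`exists_lift_QWeight`). Such a `p` is pointwise fully faithful, so a lift is determined by its
  effect on objects, which need only be compatible with the 1-cells of `J` (`liftObj`). The object
  sets of `QW` are free under the 1-cells of `J` on the sets of objects of the `W i`, so lifts of
  objects can be chosen on these generators, by surjectivity of `p` on objects.

If `W` is cofibrant, lifting `1_W` through `q_W` gives a section. If `s` is a section of `q_W` and
`p : E ⟶ B` is a pointwise trivial fibration, then `v : W ⟶ B` lifts through `p` to `s ≫ k`, where
`k` is a lift of `q_W ≫ v`.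
-/

namespace CatWeight

variable {J : Type u} [Bicategory.{u, u} J]

namespace TwoNatTrans

variable {W X : Weight J} (α : TwoNatTrans W X)

theorem naturality_obj {a b : J} (f : a ⟶ b) (x : W.obj a) :
    (α.app b).toFunctor.obj ((W.map f).toFunctor.obj x) =
      (X.map f).toFunctor.obj ((α.app a).toFunctor.obj x) :=
  congrArg (fun F => F.toFunctor.obj x) (α.naturality f)

theorem naturality_map {a b : J} (f : a ⟶ b) {x y : W.obj a} (m : x ⟶ y) :
    (α.app b).toFunctor.map ((W.map f).toFunctor.map m) =
      eqToHom (α.naturality_obj f x) ≫ (X.map f).toFunctor.map ((α.app a).toFunctor.map m) ≫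
        eqToHom (α.naturality_obj f y).symm :=
  CategoryTheory.Functor.congr_hom (congrArg (fun F => F.toFunctor) (α.naturality f)) m

theorem naturality₂_app {a b : J} {f g : a ⟶ b} (η : f ⟶ g) (x : W.obj a) :
    (α.app b).toFunctor.map ((W.map₂ η).toNatTrans.app x) =
      eqToHom (α.naturality_obj f x) ≫ (X.map₂ η).toNatTrans.app ((α.app a).toFunctor.obj x) ≫
        eqToHom (α.naturality_obj g x).symm := by
  have h := congrArg (fun t => t.toNatTrans.app x) (α.naturality₂ η)
  rw [Cat.Hom₂.comp_app, Cat.Hom₂.comp_app, Cat.eqToHom_app, Cat.eqToHom_app] at h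
  rw [← cancel_mono (eqToHom (α.naturality_obj g x))]
  refine h.trans ?_
  simp only [Category.assoc, eqToHom_trans, eqToHom_refl]
  exact congrArg _ (Category.comp_id _).symm

/-- A 2-natural transformation from functors satisfying the naturality conditions on objects,
arrows and components of 2-cells. -/
def ofApp (F : ∀ j, W.obj j ⟶ X.obj j)
    (obj : ∀ {a b : J} (f : a ⟶ b) (x : W.obj a),
      (F b).toFunctor.obj ((W.map f).toFunctor.obj x) =
        (X.map f).toFunctor.obj ((F a).toFunctor.obj x))
    (map : ∀ {a b : J} (f : a ⟶ b) (x y : W.obj a) (m : x ⟶ y),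
      (F b).toFunctor.map ((W.map f).toFunctor.map m) =
        eqToHom (obj f x) ≫ (X.map f).toFunctor.map ((F a).toFunctor.map m) ≫
          eqToHom (obj f y).symm)
    (map₂ : ∀ {a b : J} {f g : a ⟶ b} (η : f ⟶ g) (x : W.obj a),
      (F b).toFunctor.map ((W.map₂ η).toNatTrans.app x) ≫ eqToHom (obj g x) =
        eqToHom (obj f x) ≫ (X.map₂ η).toNatTrans.app ((F a).toFunctor.obj x)) :
    TwoNatTrans W X where
  app := F
  naturality f := by
    ext1
    exact CategoryTheory.Functor.ext (obj f) (map f)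
  naturality₂ η := by
    ext x
    rw [Cat.Hom₂.comp_app, Cat.Hom₂.comp_app, Cat.eqToHom_app, Cat.eqToHom_app]
    exact map₂ η x

end TwoNatTrans

section ObjectLift

variable {A E B : Weight J} {p : TwoNatTrans E B} (hp : ∀ j, (p.app j).toFunctor.FullyFaithful)
  (h : TwoNatTrans A B) (k : ∀ j, A.obj j → E.obj j)
  (hk : ∀ j x, (p.app j).toFunctor.obj (k j x) = (h.app j).toFunctor.obj x)

/-- If `p` is pointwise fully faithful, a lift of `h` through `p` on objects extends to arrows. -/
abbrev liftObjFunctor (j : J) : A.obj j ⥤ E.obj j where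
  obj := k j
  map {x y} m := (hp j).preimage
    (eqToHom (hk j x) ≫ (h.app j).toFunctor.map m ≫ eqToHom (hk j y).symm)
  map_id x := (hp j).map_injective (by simp)
  map_comp m n := (hp j).map_injective (by simp)

theorem map_liftObjFunctor (j : J) {x y : A.obj j} (m : x ⟶ y) :
    (p.app j).toFunctor.map ((liftObjFunctor hp h k hk j).map m) =
      eqToHom (hk j x) ≫ (h.app j).toFunctor.map m ≫ eqToHom (hk j y).symm :=
  (hp j).map_preimage _

theorem liftObjFunctor_map₂ {a b : J} {f g : a ⟶ b} (η : f ⟶ g) (x : A.obj a)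
    (hf : k b ((A.map f).toFunctor.obj x) = (E.map f).toFunctor.obj (k a x))
    (hg : k b ((A.map g).toFunctor.obj x) = (E.map g).toFunctor.obj (k a x)) :
    (liftObjFunctor hp h k hk b).map ((A.map₂ η).toNatTrans.app x) ≫ eqToHom hg =
      eqToHom hf ≫ (E.map₂ η).toNatTrans.app (k a x) := by
  refine (hp b).map_injective ?_
  rw [Functor.map_comp, Functor.map_comp, map_liftObjFunctor, h.naturality₂_app,
    p.naturality₂_app, map_congr_obj (B.map₂ η).toNatTrans (hk a x), eqToHom_map, eqToHom_map]
  simp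

theorem liftObjFunctor_map_map {a b : J} (f : a ⟶ b)
    (hf : ∀ x, k b ((A.map f).toFunctor.obj x) = (E.map f).toFunctor.obj (k a x))
    {x y : A.obj a} (m : x ⟶ y) :
    (liftObjFunctor hp h k hk b).map ((A.map f).toFunctor.map m) =
      eqToHom (hf x) ≫ (E.map f).toFunctor.map ((liftObjFunctor hp h k hk a).map m) ≫
        eqToHom (hf y).symm := by
  refine (hp b).map_injective ?_
  rw [Functor.map_comp, Functor.map_comp, map_liftObjFunctor, h.naturality_map,
    p.naturality_map, map_liftObjFunctor, eqToHom_map, eqToHom_map]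
  simp [eqToHom_map]

/-- If `p` is pointwise fully faithful, a lift of `h` through `p` on objects that commutes with
the 1-cells of `J` extends to a 2-natural lift: faithfulness forces the remaining equations. -/
def liftObj (hk' : ∀ {a b : J} (f : a ⟶ b) (x : A.obj a),
      k b ((A.map f).toFunctor.obj x) = (E.map f).toFunctor.obj (k a x)) :
    TwoNatTrans A E :=
  TwoNatTrans.ofApp (fun j => (liftObjFunctor hp h k hk j).toCatHom) hk'
    (fun f _ _ m => liftObjFunctor_map_map hp h k hk f (hk' f) m)
    (fun {_ _ f g} η x => liftObjFunctor_map₂ hp h k hk η x (hk' f x) (hk' g x))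

theorem liftObj_comp (hk' : ∀ {a b : J} (f : a ⟶ b) (x : A.obj a),
      k b ((A.map f).toFunctor.obj x) = (E.map f).toFunctor.obj (k a x)) :
    (show A ⟶ E from liftObj hp h k hk hk') ≫ (show E ⟶ B from p) = h := by
  apply TwoNatTrans.ext
  funext j
  ext1
  exact CategoryTheory.Functor.ext (hk j) (fun x y m => map_liftObjFunctor hp h k hk j m)

end ObjectLift

/-- An isofibration that is essentially surjective is surjective on objects. -/
theorem IsIsofibration.surjective {C D : Cat.{u, u}} {F : C ⟶ D} (hF : IsIsofibration F)
    [F.toFunctor.EssSurj] : Function.Surjective F.toFunctor.obj := fun y =>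
  have ⟨z, _, h, _⟩ := hF _ y (F.toFunctor.objObjPreimageIso y)
  ⟨z, h⟩

theorem isIsofibration_of_surjective {C D : Cat.{u, u}} {F : C ⟶ D}
    (hF : F.toFunctor.FullyFaithful) (hF' : Function.Surjective F.toFunctor.obj) :
    IsIsofibration F := fun x y e => by
  obtain ⟨z, rfl⟩ := hF' y
  exact ⟨z, hF.preimageIso e, rfl, by simp⟩

variable [Bicategory.Strict J]

/-- The weight `QW` is projective with respect to the pointwise trivial fibrations. Its objects
`f · x` are freely generated under the 1-cells of `J` by the objects `1 · x`, so a lift may be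
chosen on the latter. -/
theorem exists_lift_QWeight (W : Weight J) {E B : Weight J} (p : E ⟶ B)
    (hp : (pointwiseIsofibrations J ⊓ pointwiseEquivalences J) p) (h : QWeight W ⟶ B) :
    ∃ k : QWeight W ⟶ E, k ≫ p = h := by
  obtain ⟨hp₁, hp₂⟩ := hp
  have ff (j : J) : (TwoNatTrans.app p j).toFunctor.FullyFaithful :=
    have := hp₂ j
    .ofFullyFaithful _
  have surj (j : J) : Function.Surjective (TwoNatTrans.app p j).toFunctor.obj :=
    have := hp₂ j
    (hp₁ j).surjective
  -- `c j x` lifts the value of `h` at the generator `1 · x`, and `f · x` is sent to `E(f)(c x)`.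
  choose c hc using fun (j : J) (x : W.obj j) =>
    surj j ((TwoNatTrans.app h j).toFunctor.obj ((unitApp W j).obj x))
  refine ⟨liftObj ff h (fun j q => (E.map q.arr).toFunctor.obj (c q.src q.elt))
    (fun j q => ?_) (fun f q => E.map_comp_obj q.arr f _), liftObj_comp _ _ _ _ _⟩
  exact (TwoNatTrans.naturality_obj p q.arr _).trans
    ((congrArg (B.map q.arr).toFunctor.obj (hc q.src q.elt)).trans (lift_unit_obj h q))

/-- The counit corresponds to the identity pseudonatural transformation under the adjunction. -/
theorem q_eq_lift_id (W : Weight J) :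
    q W = lift (Pseudofunctor.StrongTrans.id W.toPs) := rfl

theorem lift_id_app_map (W : Weight J) (j : J) {x y : QObj W j} (m : x ⟶ y) :
    ((lift (Pseudofunctor.StrongTrans.id W.toPs)).app j).toFunctor.map m = m.val := by
  change (𝟙 _ ≫ 𝟙 _) ≫ m.val ≫ (𝟙 _ ≫ 𝟙 _) = _
  simp

/-- The counit is a pointwise trivial fibration: at each `j` it is evaluation `f · x ↦ W(f)(x)`,
which is fully faithful by the definition of the arrows of `QW` and hits `x` at `1 · x`. -/
theorem q_trivialFibration (W : Weight J) :
    (pointwiseIsofibrations J ⊓ pointwiseEquivalences J) (q W) := by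
  rw [q_eq_lift_id]
  have ff (j : J) : ((lift (Pseudofunctor.StrongTrans.id W.toPs)).app j).toFunctor.FullyFaithful :=
    { preimage := fun m => ⟨m⟩
      map_preimage := fun m => lift_id_app_map W j _
      preimage_map := fun m => QObj.hom_ext (lift_id_app_map W j m) }
  have surj (j : J) : Function.Surjective
      ((lift (Pseudofunctor.StrongTrans.id W.toPs)).app j).toFunctor.obj :=
    fun x => ⟨(unitApp W j).obj x, W.map_id_obj j x⟩
  refine ⟨fun j => isIsofibration_of_surjective (ff j) (surj j), fun j => ?_⟩
  exact { full := (ff j).full, faithful := (ff j).faithful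
          essSurj := ⟨fun y => (surj j y).imp fun x hx => ⟨eqToIso hx⟩⟩ }

/-- Both directions are lifting problems: for `q_W` itself a lift is a section, and conversely a
section exhibits `W` as a retract of `QW`, which lifts against all pointwise trivial fibrations. -/
theorem projectiveCofibrations_initial_to_iff (W : Weight J) :
    projectiveCofibrations J (Limits.initial.to W) ↔ IsFlexible W := by
  constructor
  · intro hW
    have := hW (q W) (q_trivialFibration W)
    have sq : CommSq (Limits.initial.to (Q.obj (inclusion.obj W))) (Limits.initial.to W) (q W)
      (𝟙 W) := ⟨Limits.initialIsInitial.hom_ext _ _⟩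
    exact ⟨sq.lift, sq.fac_right⟩
  · rintro ⟨s, hs⟩ E B p hp
    refine ⟨fun {_ v} _ => ?_⟩
    obtain ⟨k, hk⟩ := exists_lift_QWeight W p hp (q W ≫ v)
    -- `(s ≫ k) ≫ p = s ≫ (q W ≫ v) = v`
    refine ⟨⟨⟨s ≫ k, Limits.initialIsInitial.hom_ext _ _, ?_⟩⟩⟩
    exact (Category.assoc _ _ _).trans ((congrArg (s ≫ ·) hk).trans
      ((Category.assoc _ _ _).symm.trans ((congrArg (· ≫ v) hs).trans (Category.id_comp v))))

end CatWeight

theorem mainTheorem7 (J : Type u) [Bicategory.{u, u} J] [Bicategory.Strict J] :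
    (∀ W : CatWeight.Weight J,
      CatWeight.projectiveCofibrations J (Limits.initial.to W) ↔ CatWeight.IsFlexible W) ∧
    (∀ [HomotopicalAlgebra.ModelCategory (CatWeight.Weight J)], CatWeight.IsProjective J →
      ∀ W : CatWeight.Weight J,
        HomotopicalAlgebra.IsCofibrant W ↔ CatWeight.IsFlexible W) := by
  refine ⟨CatWeight.projectiveCofibrations_initial_to_iff, fun hJ W => ?_⟩
  rw [HomotopicalAlgebra.isCofibrant_iff, HomotopicalAlgebra.cofibration_iff,
    hJ.cofibrations_eq]
  exact CatWeight.projectiveCofibrations_initial_to_iff W
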